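/- Notation. $\overline{\mathbb R}=\mathbb R\cup\{\pm\infty\}$; $\Gamma_0(\mathbb R)$ is the set of proper, lower semicontinuous, convex functions $\mathbb R\to\overline{\mathbb R}$. Let $\varphi:\mathbb R\to\mathbb R$ be a reference function, that is, $\varphi\in\Gamma_0(\mathbb R)$ is real-valued, Legendre (essentially smooth and essentially strictly convex) and super-coercive ($\varphi(x)/|x|\to\infty$ as $|x|\to\infty$). Its convex conjugate $\varphi^*(v)=\sup_{x}\{xv-\varphi(x)\}$ is then finite and differentiable on $\mathbb R$. Put $\Phi(x,y)=\varphi(x-y)$. A function $F:\mathbb R\to\overline{\mathbb R}$ is $\Phi$-convex if there is a set $A\subseteq\mathbb R\times\overline{\mathbb R}$ with $F(x)=\sup_{(y,\beta)\in A}\{\Phi(x,y)-\beta\}$ for all $x$, its $\Phi$-conjugate is $F^\Phi(y)=\sup_{x\in\mathbb R}\{\Phi(x,y)-F(x)\}$, and for $g:\mathbb R\to\overline{\mathbb R}$ the supremal convolution is $((-g)\mathbin{\Diamond}\varphi)(x)=\sup_{y\in\mathbb R}\{\varphi(x-y)-g(y)\}$. A proper lower semicontinuous function $F:\mathbb R\to\overline{\mathbb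 R}$ is anisotropically strongly convex (relative to $\varphi$) if for all $\bar x\in\mathbb R$ and all $\bar v$ in the limiting subdifferential $\partial F(\bar x)$, $$F(x)\ \ge\ F(\bar x)+\varphi\bigl(x-\bar x+(\varphi^*)'(\bar v)\bigr)-\varphi\bigl((\varphi^*)'(\bar v)\bigr)\qquad\text{for all }x\in\mathbb R.$$ Proposition. Let $f:\mathbb R\to\mathbb R$ be finite-valued. Then $f$ is $\Phi$-convex if and only if $f=(-g)\mathbin{\Diamond}\varphi$ for some $g\in\Gamma_0(\mathbb R)$. If $f$ is $\Phi$-convex, then $f$ is anisotropically strongly convex, and for every $\bar v\in\mathbb R$ the following saddle-point property holds: $$\sup_{x\in\mathbb R}\inf_{y\in\mathbb R}\bigl\{x\bar v-\Phi(x,y)+f^\Phi(y)\bigr\}=\inf_{y\in\mathbb R}\sup_{x\in\mathbb R}\bigl\{x\bar v-\Phi(x,y)+f^\Phi(y)\bigr\}.$$ -/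

import Mathlib

open Filter Topology

noncomputable section

/-! Extended real-valued functions on the real line -/

/-- The effective domain of `f`. -/
def effDom (f : ℝ → EReal) : Set ℝ := {x | f x < ⊤}

/-- `f` is proper: it never takes the value `-∞` and its effective domain is nonempty. -/
def IsProperFun (f : ℝ → EReal) : Prop :=
  (∀ x, ⊥ < f x) ∧ (effDom f).Nonempty

/-- `f` is convex, i.e. its epigraph is a convex set. -/
def IsConvexFun (f : ℝ → EReal) : Prop :=
  Convex ℝ {p : ℝ × ℝ | f p.1 ≤ (p.2 : EReal)}

/-- Membership in `Γ₀(ℝ)`: proper, lower semicontinuous and convex. -/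
structure IsGammaZero (f : ℝ → EReal) : Prop where
  proper : IsProperFun f
  lsc : LowerSemicontinuous f
  convex : IsConvexFun f

/-- The regular (Fréchet) subdifferential of `f` at a point `a`; it is empty
where `f` is not finite. -/
def regularSubdiff (f : ℝ → EReal) (a : ℝ) : Set ℝ :=
  {v | f a ≠ ⊤ ∧ f a ≠ ⊥ ∧
    0 ≤ liminf (fun x : ℝ => (f x - f a - ((v * (x - a) : ℝ) : EReal)) / ((|x - a| : ℝ) : EReal))
      (𝓝[≠] a)}

/-- The limiting subdifferential of `f` at a point `a`. -/
def limitingSubdiff (f : ℝ → EReal) (a : ℝ) : Set ℝ :=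
  {v | a ∈ effDom f ∧ ∃ (x w : ℕ → ℝ), (∀ k, w k ∈ regularSubdiff f (x k)) ∧
    Tendsto x atTop (𝓝 a) ∧ Tendsto w atTop (𝓝 v) ∧
    Tendsto (fun k => f (x k)) atTop (𝓝 (f a))}

/-- The convex conjugate `f*(v) = sup_x x v - f(x)`. -/
def convexConj (f : ℝ → EReal) (v : ℝ) : EReal :=
  ⨆ x : ℝ, ((x * v : ℝ) : EReal) - f x

/-- The derivative of an extended real-valued function, meaningful at points near
which the function is finite and at which it is differentiable. -/
def erealDeriv (f : ℝ → EReal) (x : ℝ) : ℝ :=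
  deriv (fun t => (f t).toReal) x

/-- Essential smoothness (for functions in `Γ₀(ℝ)`): the domain has nonempty interior, `f` is
differentiable there, and the derivative blows up when the boundary of the domain is approached. -/
def IsEssentiallySmooth (f : ℝ → EReal) : Prop :=
  (interior (effDom f)).Nonempty ∧
  (∀ x ∈ interior (effDom f), DifferentiableAt ℝ (fun t => (f t).toReal) x) ∧
  ∀ (u : ℕ → ℝ), (∀ k, u k ∈ interior (effDom f)) → ∀ x ∈ frontier (effDom f),
    Tendsto u atTop (𝓝 x) → Tendsto (fun k => |erealDeriv f (u k)|) atTop atTop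

/-- Essential strict convexity (for functions in `Γ₀(ℝ)`): strict convexity on every convex
subset of the domain of the subdifferential (where `f` is finite). -/
def IsEssentiallyStrictlyConvex (f : ℝ → EReal) : Prop :=
  ∀ C : Set ℝ, Convex ℝ C → C ⊆ {x | (limitingSubdiff f x).Nonempty} →
    StrictConvexOn ℝ C (fun t => (f t).toReal)

/-- Legendre functions. -/
structure IsLegendre (f : ℝ → EReal) : Prop where
  gammaZero : IsGammaZero f
  essentiallySmooth : IsEssentiallySmooth f
  essentiallyStrictlyConvex : IsEssentiallyStrictlyConvex f

/-- A real-valued function on `ℝ` as an extended real-valued one. -/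
def toExt (f : ℝ → ℝ) : ℝ → EReal := fun x => (f x : EReal)

/-- The standing assumptions on the reference function `φ`: it is Legendre, its domain is all
of `ℝ` (it is real-valued), and it is super-coercive. -/
structure IsReferenceFunction (φ : ℝ → ℝ) : Prop where
  legendre : IsLegendre (toExt φ)
  superCoercive : Tendsto (fun x => φ x / |x|) (cocompact ℝ) atTop

/-! Generalized convexity with respect to a real-valued coupling -/

/-- (Left) `Φ`-convexity: `f` is a pointwise supremum of functions `Φ(·, y) - β` over a (possibly
empty) set of pairs `(y, β)`; the supremum over the empty set is `-∞`. -/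
def IsPhiConvex {X Y : Type*} (Φ : X → Y → ℝ) (f : X → EReal) : Prop :=
  ∃ A : Set (Y × EReal), ∀ x, f x = ⨆ p ∈ A, (Φ x p.1 : EReal) - p.2

/-- The (left) `Φ`-conjugate `f^Φ(y) = sup_x Φ(x, y) - f(x)`. -/
def phiConj {X Y : Type*} (Φ : X → Y → ℝ) (f : X → EReal) (y : Y) : EReal :=
  ⨆ x : X, (Φ x y : EReal) - f x

/-- The coupling `Φ(x, y) = φ(x - y)`. -/
def shiftCoupling (φ : ℝ → ℝ) (x y : ℝ) : ℝ := φ (x - y)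

/-- The supremal convolution `(u ◇ φ)(x) = sup_y φ(x - y) + u(y)`, with `φ` real-valued. -/
def supConv (u : ℝ → EReal) (φ : ℝ → ℝ) (x : ℝ) : EReal :=
  ⨆ y : ℝ, (φ (x - y) : EReal) + u y

/-- Anisotropic strong convexity of `f` relative to the reference function `φ`. For a reference
function, the conjugate `φ*` is finite and differentiable, with derivative inverse to that of `φ`. -/
structure IsAnisotropicallyStronglyConvex (φ : ℝ → ℝ) (f : ℝ → EReal) : Prop where
  proper : IsProperFun f
  lsc : LowerSemicontinuous f
  subgradient_ineq : ∀ a v : ℝ, v ∈ limitingSubdiff f a → ∀ x : ℝ,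
    f a + ((φ (x - a + erealDeriv (convexConj (toExt φ)) v) : ℝ) : EReal)
      - ((φ (erealDeriv (convexConj (toExt φ)) v) : ℝ) : EReal) ≤ f x

/-- The saddle-point property for `f` and the slope `v`:
`sup_x inf_y x v - Φ(x, y) + f^Φ(y) = inf_y sup_x x v - Φ(x, y) + f^Φ(y)`. -/
def SaddlePointProperty (Φ : ℝ → ℝ → ℝ) (f : ℝ → EReal) (v : ℝ) : Prop :=
  (⨆ x : ℝ, ⨅ y : ℝ, ((x * v - Φ x y : ℝ) : EReal) + phiConj Φ f y) =
    ⨅ y : ℝ, ⨆ x : ℝ, ((x * v - Φ x y : ℝ) : EReal) + phiConj Φ f y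

end

/-! ### Convex functions on the real line -/

/-! A finite `Φ`-convex `f` is a supremum of shifts `φ(· - y) - c`, hence convex and continuous, and
the least offset for `y` is `f^Φ(y)`; so `g = f^Φ` gives the representation, and `g` is in `Γ₀` as a
supremum of convex continuous functions of `y`. The core is `IsSupOfShifts.sub_le_sub`: if `φ'(s)`
is a subgradient of `f` at `a`, the shift of `φ` through `(a, f a)` with that slope lies below `f`.
Limiting subgradients of `f` are global ones and `(φ*)'` inverts `φ'`, so this is anisotropic strong
convexity. It also gives `f^Φ(a - s) ≤ φ(s) - f(a)`. The sup-inf is at least `f*(v)`, and evaluating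
the inf-sup at `y = a - s`, for a subgradient `φ'(s)` close to `v`, bounds it by `f*(v)` plus an
arbitrarily small error. Nearby slopes are needed because `f*(v)` may be finite without being
attained. -/

theorem ConvexOn.add_sub_le_add_sub {f : ℝ → ℝ} (hf : ConvexOn ℝ Set.univ f) {u w d : ℝ}
    (huw : u ≤ w) (hd : 0 ≤ d) : f (u + d) - f u ≤ f (w + d) - f w := by
  rcases hd.eq_or_lt with rfl | hd
  · simp
  have hs : 0 < w - u + d := by linarith
  -- Both `u + d` and `w` are convex combinations of `u` and `w + d`, with swapped weights; adding
  -- the two convexity inequalities gives the claim.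
  set θ : ℝ := d / (w - u + d) with hθ
  have hθ0 : 0 ≤ θ := by positivity
  have hθ1 : 0 ≤ 1 - θ := by
    have : θ ≤ 1 := (div_le_one hs).2 (by linarith)
    linarith
  have hθs : θ * (w - u + d) = d := div_mul_cancel₀ _ hs.ne'
  have h1 := hf.2 (Set.mem_univ u) (Set.mem_univ (w + d)) hθ1 hθ0 (by ring)
  have h2 := hf.2 (Set.mem_univ u) (Set.mem_univ (w + d)) hθ0 hθ1 (by ring)
  simp only [smul_eq_mul] at h1 h2
  rw [show (1 - θ) * u + θ * (w + d) = u + d by linear_combination hθs] at h1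
  rw [show θ * u + (1 - θ) * (w + d) = w by linear_combination -hθs] at h2
  linarith

/-- A convex function that touches a differentiable minorant at `a` lies above the tangent line
of the minorant at `a`. -/
theorem ConvexOn.add_mul_le_of_forall_sub_le_sub {f q : ℝ → ℝ} (hf : ConvexOn ℝ Set.univ f)
    {a q' : ℝ} (hq : HasDerivAt q q' a) (h : ∀ x, q x - q a ≤ f x - f a) (x : ℝ) :
    f a + q' * (x - a) ≤ f x := by
  have hline : HasDerivAt (fun t : ℝ => q (a + t * (x - a))) (q' * (x - a)) 0 := by
    have h1 : HasDerivAt (fun t : ℝ => a + t * (x - a)) (x - a) 0 := by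
      simpa using ((hasDerivAt_id (0 : ℝ)).mul_const (x - a)).const_add a
    have h2 : HasDerivAt q q' (a + 0 * (x - a)) := by simpa using hq
    exact h2.comp 0 h1
  have hlim := (hasDerivAt_iff_tendsto_slope.1 hline).mono_left
    (nhdsWithin_mono 0 (fun t (ht : t ∈ Set.Ioi (0 : ℝ)) => ne_of_gt ht))
  have key : q' * (x - a) ≤ f x - f a := by
    refine le_of_tendsto hlim ?_
    filter_upwards [Ioo_mem_nhdsGT (zero_lt_one' ℝ)] with t ht
    rw [slope_def_field]
    simp only [zero_mul, add_zero, sub_zero]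
    rw [div_le_iff₀ ht.1]
    have h1 := h (a + t * (x - a))
    have h2 := hf.2 (Set.mem_univ a) (Set.mem_univ x) (by linarith [ht.2] : 0 ≤ 1 - t) ht.1.le
      (by ring)
    simp only [smul_eq_mul] at h2
    rw [show (1 - t) * a + t * x = a + t * (x - a) by ring] at h2
    linarith
  linarith

theorem ConvexOn.add_deriv_mul_le {f : ℝ → ℝ} (hf : ConvexOn ℝ Set.univ f)
    (hd : Differentiable ℝ f) (a x : ℝ) : f a + deriv f a * (x - a) ≤ f x :=
  hf.add_mul_le_of_forall_sub_le_sub (hd a).hasDerivAt (fun _ => le_rfl) x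

theorem exists_deriv_eq_of_tendsto_div_abs {φ : ℝ → ℝ} (hd : Differentiable ℝ φ)
    (hφ : Tendsto (fun x => φ x / |x|) (cocompact ℝ) atTop) (v : ℝ) : ∃ s, deriv φ s = v := by
  have habs : Tendsto (fun x : ℝ => |x|) (cocompact ℝ) atTop := tendsto_norm_cocompact_atTop
  have hlim : Tendsto (fun x => φ x - v * x) (cocompact ℝ) atTop := by
    refine tendsto_atTop_mono' _ ?_ habs
    filter_upwards [hφ.eventually_ge_atTop (|v| + 1), habs.eventually_gt_atTop 0] with x h1 h2
    rw [le_div_iff₀ h2] at h1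
    have := le_abs_self (v * x)
    rw [abs_mul] at this
    linarith
  have hdiff : Differentiable ℝ (fun x => φ x - v * x) := by fun_prop
  obtain ⟨s, hs⟩ := hdiff.continuous.exists_forall_le hlim
  refine ⟨s, ?_⟩
  have h0 : IsLocalMin (fun x => φ x - v * x) s := Eventually.of_forall hs
  have h1 : HasDerivAt (fun x => φ x - v * x) (deriv φ s - v) s := by
    have h2 := (hd s).hasDerivAt.sub ((hasDerivAt_id s).const_mul v)
    rw [mul_one] at h2
    exact h2
  linarith [h0.hasDerivAt_eq_zero h1]

/-- If `x v - f x` is bounded above then `f` has subgradients arbitrarily close to `v`. -/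
theorem ConvexOn.exists_subgradient_near {f : ℝ → ℝ} (hf : ConvexOn ℝ Set.univ f) {v c ε : ℝ}
    (hc : ∀ x, x * v - f x ≤ c) (hε : 0 < ε) :
    ∃ a w, |w - v| ≤ ε ∧ ∀ x, f a + w * (x - a) ≤ f x := by
  have hcont : Continuous f := continuousOn_univ.1 (hf.continuousOn isOpen_univ)
  -- The smooth perturbation makes `f - q` coercive, hence minimized somewhere, and shifts the slope
  -- `v` by at most `ε`.
  set q : ℝ → ℝ := fun x => x * v - ε * √(1 + x ^ 2) with hq
  have hsq : ∀ x : ℝ, |x| ≤ √(1 + x ^ 2) := fun x => by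
    rw [← Real.sqrt_sq_eq_abs]; exact Real.sqrt_le_sqrt (by linarith)
  have hlim : Tendsto (fun x => f x - q x) (cocompact ℝ) atTop := by
    have habs : Tendsto (fun x : ℝ => -c + ε * |x|) (cocompact ℝ) atTop :=
      tendsto_atTop_add_const_left _ _
        (Tendsto.const_mul_atTop hε tendsto_norm_cocompact_atTop)
    refine tendsto_atTop_mono (fun x => ?_) habs
    have h1 := mul_le_mul_of_nonneg_left (hsq x) hε.le
    have h2 := hc x
    simp only [hq]
    linarith
  obtain ⟨a, ha : ∀ x, f a - q a ≤ f x - q x⟩ := (hcont.sub (by fun_prop : Continuous q)).exists_forall_le hlim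
  have hpos : 0 < √(1 + a ^ 2) := Real.sqrt_pos.2 (by positivity)
  have hder : HasDerivAt q (v - ε * (a / √(1 + a ^ 2))) a := by
    have h1 : HasDerivAt (fun x : ℝ => 1 + x ^ 2) (2 * a) a := by
      simpa using (hasDerivAt_pow 2 a).const_add 1
    have h2 := (h1.sqrt (by positivity)).const_mul ε
    have h3 := ((hasDerivAt_id a).mul_const v).sub h2
    have h4 : v - ε * (a / √(1 + a ^ 2)) = 1 * v - ε * (2 * a / (2 * √(1 + a ^ 2))) := by
      rw [one_mul, mul_div_mul_left _ _ two_ne_zero]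
    rw [h4]
    exact h3
  refine ⟨a, _, ?_, hf.add_mul_le_of_forall_sub_le_sub hder fun x => by linarith [ha x]⟩
  rw [sub_sub_cancel_left, abs_neg, abs_mul, abs_of_pos hε, abs_div, abs_of_pos hpos]
  exact mul_le_of_le_one_right hε.le ((div_le_one hpos).2 (hsq a))

/-! ### Subdifferentials of finite convex functions -/

theorem regularSubdiff_quotient_eq_coe {f : ℝ → ℝ} (v a x : ℝ) :
    ((toExt f x - toExt f a - ((v * (x - a) : ℝ) : EReal)) / ((|x - a| : ℝ) : EReal)) =
      (((f x - f a - v * (x - a)) / |x - a| : ℝ) : EReal) := by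
  simp only [toExt, EReal.coe_div, EReal.coe_sub]

theorem mem_regularSubdiff_of_forall_le {f : ℝ → ℝ} {a v : ℝ}
    (h : ∀ x, f a + v * (x - a) ≤ f x) : v ∈ regularSubdiff (toExt f) a := by
  refine ⟨EReal.coe_ne_top _, EReal.coe_ne_bot _, le_liminf_of_le (by isBoundedDefault) ?_⟩
  refine Eventually.of_forall fun x => ?_
  rw [regularSubdiff_quotient_eq_coe]
  exact EReal.coe_nonneg.2 (div_nonneg (by linarith [h x]) (abs_nonneg _))

theorem mem_limitingSubdiff_of_forall_le {f : ℝ → ℝ} {a v : ℝ}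
    (h : ∀ x, f a + v * (x - a) ≤ f x) : v ∈ limitingSubdiff (toExt f) a :=
  ⟨EReal.coe_lt_top _, fun _ => a, fun _ => v, fun _ => mem_regularSubdiff_of_forall_le h,
    tendsto_const_nhds, tendsto_const_nhds, tendsto_const_nhds⟩

/-- By convexity, the quotient along the segment from `a` to `x` is at most its value at `x`; one
violation would thus make the liminf negative. -/
theorem ConvexOn.add_mul_le_of_mem_regularSubdiff {f : ℝ → ℝ} (hf : ConvexOn ℝ Set.univ f)
    {a v : ℝ} (hv : v ∈ regularSubdiff (toExt f) a) (x : ℝ) : f a + v * (x - a) ≤ f x := by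
  by_contra! hlt
  have hxa : x - a ≠ 0 := by
    intro h0
    rw [h0, sub_eq_zero.1 h0] at hlt
    simp at hlt
  set δ : ℝ := (f x - f a - v * (x - a)) / |x - a| with hδ
  have hδ0 : δ < 0 := div_neg_of_neg_of_pos (by linarith) (abs_pos.2 hxa)
  have htend : Tendsto (fun t : ℝ => a + t * (x - a)) (𝓝[>] 0) (𝓝[≠] a) := by
    refine tendsto_nhdsWithin_iff.2 ⟨?_, ?_⟩
    · have : Continuous (fun t : ℝ => a + t * (x - a)) := by fun_prop
      simpa using (this.tendsto 0).mono_left nhdsWithin_le_nhds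
    · filter_upwards [self_mem_nhdsWithin] with t ht
      have : t * (x - a) ≠ 0 := mul_ne_zero (ne_of_gt ht) hxa
      simpa using this
  have hfreq : ∃ᶠ y in 𝓝[≠] a,
      ((toExt f y - toExt f a - ((v * (y - a) : ℝ) : EReal)) / ((|y - a| : ℝ) : EReal)) ≤
        (δ : EReal) := by
    refine htend.frequently (Eventually.frequently ?_)
    filter_upwards [Ioo_mem_nhdsGT (zero_lt_one' ℝ)] with t ht
    rw [regularSubdiff_quotient_eq_coe, EReal.coe_le_coe_iff, add_sub_cancel_left, abs_mul,
      abs_of_pos ht.1, div_le_iff₀ (mul_pos ht.1 (abs_pos.2 hxa)), hδ]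
    have h2 := hf.2 (Set.mem_univ a) (Set.mem_univ x) (by linarith [ht.2] : 0 ≤ 1 - t) ht.1.le
      (by ring)
    simp only [smul_eq_mul] at h2
    rw [show (1 - t) * a + t * x = a + t * (x - a) by ring] at h2
    have h3 : (f x - f a - v * (x - a)) / |x - a| * (t * |x - a|) =
        t * (f x - f a - v * (x - a)) := by
      have := abs_ne_zero.2 hxa
      field_simp
    rw [h3]
    linarith
  have h0 : (0 : EReal) ≤ δ := hv.2.2.trans (liminf_le_of_frequently_le' hfreq)
  exact absurd (EReal.coe_nonneg.1 h0) (not_le.2 hδ0)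

theorem ConvexOn.add_mul_le_of_mem_limitingSubdiff {f : ℝ → ℝ} (hf : ConvexOn ℝ Set.univ f)
    {a v : ℝ} (hv : v ∈ limitingSubdiff (toExt f) a) (x : ℝ) : f a + v * (x - a) ≤ f x := by
  obtain ⟨-, u, w, hreg, hu, hw, -⟩ := hv
  have hcont : Continuous f := continuousOn_univ.1 (hf.continuousOn isOpen_univ)
  have hlim : Tendsto (fun k => f (u k) + w k * (x - u k)) atTop (𝓝 (f a + v * (x - a))) :=
    ((hcont.tendsto a).comp hu).add (hw.mul (tendsto_const_nhds.sub hu))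
  exact le_of_tendsto hlim (Eventually.of_forall fun k =>
    hf.add_mul_le_of_mem_regularSubdiff (hreg k) x)

/-! ### Reference functions -/

namespace IsReferenceFunction

variable {φ : ℝ → ℝ}

theorem interior_effDom (φ : ℝ → ℝ) : interior (effDom (toExt φ)) = Set.univ := by
  have : effDom (toExt φ) = Set.univ := Set.eq_univ_of_forall fun x => EReal.coe_lt_top _
  rw [this, interior_univ]

theorem convexOn (hφ : IsReferenceFunction φ) : ConvexOn ℝ Set.univ φ := by
  refine ⟨convex_univ, fun x _ y _ a b ha hb hab => ?_⟩
  have h := hφ.legendre.gammaZero.convex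
    (show (x, φ x) ∈ {p : ℝ × ℝ | toExt φ p.1 ≤ (p.2 : EReal)} from le_refl (φ x : EReal))
    (show (y, φ y) ∈ {p : ℝ × ℝ | toExt φ p.1 ≤ (p.2 : EReal)} from le_refl (φ y : EReal)) ha hb hab
  exact EReal.coe_le_coe_iff.1 h

theorem differentiable (hφ : IsReferenceFunction φ) : Differentiable ℝ φ := fun x =>
  hφ.legendre.essentiallySmooth.2.1 x (by rw [interior_effDom]; trivial)

theorem strictConvexOn (hφ : IsReferenceFunction φ) : StrictConvexOn ℝ Set.univ φ :=
  hφ.legendre.essentiallyStrictlyConvex Set.univ convex_univ fun x _ =>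
    ⟨deriv φ x, mem_limitingSubdiff_of_forall_le (hφ.convexOn.add_deriv_mul_le hφ.differentiable x)⟩

theorem strictMono_deriv (hφ : IsReferenceFunction φ) : StrictMono (deriv φ) := fun x y hxy =>
  hφ.strictConvexOn.strictMonoOn_deriv (fun x _ => hφ.differentiable x) (Set.mem_univ x)
    (Set.mem_univ y) hxy

theorem surjective_deriv (hφ : IsReferenceFunction φ) : Function.Surjective (deriv φ) :=
  exists_deriv_eq_of_tendsto_div_abs hφ.differentiable hφ.superCoercive

/-- The derivative of a reference function, as an order isomorphism of the real line. -/
noncomputable def derivIso (hφ : IsReferenceFunction φ) : ℝ ≃o ℝ :=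
  hφ.strictMono_deriv.orderIsoOfSurjective _ hφ.surjective_deriv

theorem deriv_derivIso_symm (hφ : IsReferenceFunction φ) (v : ℝ) :
    deriv φ (hφ.derivIso.symm v) = v :=
  hφ.derivIso.apply_symm_apply v

theorem mul_sub_le (hφ : IsReferenceFunction φ) (x v : ℝ) :
    x * v - φ x ≤ hφ.derivIso.symm v * v - φ (hφ.derivIso.symm v) := by
  have h := hφ.convexOn.add_deriv_mul_le hφ.differentiable (hφ.derivIso.symm v) x
  rw [hφ.deriv_derivIso_symm] at h
  linarith

theorem convexConj_eq (hφ : IsReferenceFunction φ) (v : ℝ) :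
    convexConj (toExt φ) v =
      ((hφ.derivIso.symm v * v - φ (hφ.derivIso.symm v) : ℝ) : EReal) :=
  le_antisymm (iSup_le fun x => EReal.coe_le_coe_iff.2 (hφ.mul_sub_le x v))
    (le_iSup (fun x : ℝ => ((x * v : ℝ) : EReal) - toExt φ x) (hφ.derivIso.symm v))

/-- With `s` the inverse of `φ'`, Fenchel–Young at `s v` and `s w` traps the first-order remainder
of `φ*` between `0` and `(s w - s v) * (w - v)`, which is `o(w - v)` as `s` is continuous. -/
theorem erealDeriv_convexConj (hφ : IsReferenceFunction φ) (v : ℝ) :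
    erealDeriv (convexConj (toExt φ)) v = hφ.derivIso.symm v := by
  have hfun : (fun t => (convexConj (toExt φ) t).toReal) =
      fun t => hφ.derivIso.symm t * t - φ (hφ.derivIso.symm t) := by
    funext t
    rw [hφ.convexConj_eq, EReal.toReal_coe]
  rw [erealDeriv, hfun]
  refine HasDerivAt.deriv ?_
  rw [hasDerivAt_iff_isLittleO, Asymptotics.isLittleO_iff]
  intro c hc
  have hs : Continuous hφ.derivIso.symm := hφ.derivIso.symm.continuous
  filter_upwards [Metric.tendsto_nhds.1 (hs.tendsto v) c hc] with w hw
  rw [Real.dist_eq] at hw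
  have h1 := hφ.mul_sub_le (hφ.derivIso.symm v) w
  have h2 := hφ.mul_sub_le (hφ.derivIso.symm w) v
  have h3 : (hφ.derivIso.symm w - hφ.derivIso.symm v) * (w - v) ≤ c * |w - v| := by
    refine (le_abs_self _).trans ?_
    rw [abs_mul]
    exact mul_le_mul_of_nonneg_right hw.le (abs_nonneg _)
  rw [Real.norm_eq_abs, Real.norm_eq_abs, smul_eq_mul, abs_of_nonneg (by linarith)]
  linarith

end IsReferenceFunction

/-! ### Functions approximately supported by shifts of a convex function -/

/-- `f` is the pointwise supremum of the functions `φ(· - y) - c` that lie below it. -/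
def IsSupOfShifts (φ f : ℝ → ℝ) : Prop :=
  ∀ x ε, 0 < ε → ∃ y c, (∀ z, φ (z - y) - c ≤ f z) ∧ f x - ε < φ (x - y) - c

namespace IsSupOfShifts

variable {φ f : ℝ → ℝ}

theorem convexOn (hf : IsSupOfShifts φ f) (hφ : ConvexOn ℝ Set.univ φ) :
    ConvexOn ℝ Set.univ f := by
  refine ⟨convex_univ, fun x _ z _ a b ha hb hab => le_of_forall_pos_lt_add fun ε hε => ?_⟩
  obtain ⟨y, c, hle, hlt⟩ := hf (a • x + b • z) ε hε
  have h1 := hφ.2 (Set.mem_univ (x - y)) (Set.mem_univ (z - y)) ha hb hab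
  have hbe : b = 1 - a := by linarith
  subst hbe
  simp only [smul_eq_mul] at h1 hlt ⊢
  rw [show a * (x - y) + (1 - a) * (z - y) = a * x + (1 - a) * z - y by ring] at h1
  have h2 := mul_le_mul_of_nonneg_left (hle x) ha
  have h3 := mul_le_mul_of_nonneg_left (hle z) hb
  linarith

theorem comp_neg (hf : IsSupOfShifts φ f) :
    IsSupOfShifts (fun x => φ (-x)) (fun x => f (-x)) := by
  intro x ε hε
  obtain ⟨y, c, hle, hlt⟩ := hf (-x) ε hε
  refine ⟨-y, c, fun z => ?_, ?_⟩
  · simpa [sub_eq_add_neg, add_comm] using hle (-z)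
  · simpa [sub_eq_add_neg, add_comm] using hlt

/-- No shift need be active at `a`, so nearly active ones at `t > a` are used. Such a shift must
climb almost as fast as `f` from `a` to `t`, so its slope at `t` exceeds `φ'(r)` for a given `r <
s`; from there to `x` it grows at least as much as `φ` does from `r`. Then `t ↓ a` and `r ↑ s`. -/
theorem sub_le_sub_right (hf : IsSupOfShifts φ f) (hφ : ConvexOn ℝ Set.univ φ)
    (hd : Differentiable ℝ φ) (hm : StrictMono (deriv φ)) {a s x : ℝ}
    (hsub : ∀ z, f a + deriv φ s * (z - a) ≤ f z) (hx : a < x) :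
    φ (x - a + s) - φ s ≤ f x - f a := by
  have hcont : Continuous f := continuousOn_univ.1 ((hf.convexOn hφ).continuousOn isOpen_univ)
  have hφc : Continuous φ := hd.continuous
  have hstep : ∀ r < s, φ (x - a + r) - φ r ≤ f x - f a := by
    intro r hr
    have hrs := hm hr
    have hbound : ∀ t ∈ Set.Ioo a x,
        φ (x - t + r) - φ r - (deriv φ s - deriv φ r) * (t - a) ≤ f x - f t := by
      intro t ht
      have hta : 0 < t - a := sub_pos.2 ht.1
      -- This tolerance is exactly what lowers the slope bound from `φ'(s)` to `φ'(r)`.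
      obtain ⟨y, c, hle, hlt⟩ := hf t ((deriv φ s - deriv φ r) * (t - a))
        (mul_pos (sub_pos.2 hrs) hta)
      have h1 := hφ.add_deriv_mul_le hd (t - y) (a - y)
      have h2 := hsub t
      have h3 := hle a
      have h4 : deriv φ r * (t - a) < deriv φ (t - y) * (t - a) := by linarith
      have h5 : r < t - y := hm.lt_iff_lt.1 (lt_of_mul_lt_mul_right h4 hta.le)
      have h6 := hφ.add_sub_le_add_sub h5.le (sub_nonneg.2 ht.2.le)
      rw [show t - y + (x - t) = x - y by ring, add_comm r] at h6
      linarith [hle x]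
    have hl : Tendsto (fun t => φ (x - t + r) - φ r - (deriv φ s - deriv φ r) * (t - a))
        (𝓝[>] a) (𝓝 (φ (x - a + r) - φ r)) := by
      have : Continuous
          (fun t => φ (x - t + r) - φ r - (deriv φ s - deriv φ r) * (t - a)) := by fun_prop
      simpa using (this.tendsto a).mono_left nhdsWithin_le_nhds
    have hr' : Tendsto (fun t => f x - f t) (𝓝[>] a) (𝓝 (f x - f a)) :=
      ((continuous_const.sub hcont).tendsto a).mono_left nhdsWithin_le_nhds
    refine le_of_tendsto_of_tendsto hl hr' ?_
    filter_upwards [Ioo_mem_nhdsGT hx] with t ht using hbound t ht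
  have hlim : Tendsto (fun r => φ (x - a + r) - φ r) (𝓝[<] s) (𝓝 (φ (x - a + s) - φ s)) := by
    have : Continuous (fun r => φ (x - a + r) - φ r) := by fun_prop
    exact (this.tendsto s).mono_left nhdsWithin_le_nhds
  refine le_of_tendsto hlim ?_
  filter_upwards [self_mem_nhdsWithin] with r hr using hstep r hr

theorem sub_le_sub (hf : IsSupOfShifts φ f) (hφ : ConvexOn ℝ Set.univ φ)
    (hd : Differentiable ℝ φ) (hm : StrictMono (deriv φ)) {a s : ℝ}
    (hsub : ∀ z, f a + deriv φ s * (z - a) ≤ f z) (x : ℝ) :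
    φ (x - a + s) - φ s ≤ f x - f a := by
  rcases lt_trichotomy a x with hx | rfl | hx
  · exact hf.sub_le_sub_right hφ hd hm hsub hx
  · simp
  -- Points left of `a` reduce to the previous case by the reflection `x ↦ -x`, which preserves all
  -- hypotheses and sends `s` to `-s`.
  · have hder : ∀ z, deriv (fun x => φ (-x)) z = -deriv φ (-z) := deriv_comp_neg φ
    have hcv : ConvexOn ℝ Set.univ (fun x => φ (-x)) := by
      have := hφ.comp_linearMap (-LinearMap.id : ℝ →ₗ[ℝ] ℝ)
      simpa [Function.comp_def] using this
    have h := hf.comp_neg.sub_le_sub_right (a := -a) (s := -s) (x := -x) hcv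
      (hd.comp differentiable_neg)
      (fun u w huw => by rw [hder, hder]; exact neg_lt_neg (hm (neg_lt_neg huw)))
      (fun z => by
        rw [hder]
        simp only [neg_neg]
        have := hsub (-z)
        linarith) (neg_lt_neg hx)
    simp only [neg_neg] at h
    rwa [show -(-x - -a + -s) = x - a + s by ring] at h

theorem phiConj_lt_top (hf : IsSupOfShifts φ f) :
    ∃ y, phiConj (shiftCoupling φ) (toExt f) y < ⊤ := by
  obtain ⟨y, c, hle, -⟩ := hf 0 1 one_pos
  refine ⟨y, lt_of_le_of_lt (iSup_le fun x => ?_) (EReal.coe_lt_top c)⟩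
  exact EReal.coe_le_coe_iff.2 (show φ (x - y) - f x ≤ c by linarith [hle x])

end IsSupOfShifts

theorem IsPhiConvex.isSupOfShifts {φ f : ℝ → ℝ}
    (h : IsPhiConvex (shiftCoupling φ) (toExt f)) : IsSupOfShifts φ f := by
  obtain ⟨A, hA⟩ := h
  intro x ε hε
  have hlt : ((f x - ε : ℝ) : EReal) < ⨆ p ∈ A, (shiftCoupling φ x p.1 : EReal) - p.2 := by
    rw [← hA x]
    exact EReal.coe_lt_coe_iff.2 (by linarith)
  obtain ⟨⟨y, β⟩, hp⟩ := lt_iSup_iff.1 hlt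
  obtain ⟨hmem, hlt'⟩ := lt_iSup_iff.1 hp
  have hle : ∀ z, (φ (z - y) : EReal) - β ≤ (f z : EReal) := fun z => by
    have := le_iSup₂ (f := fun (p : ℝ × EReal) (_ : p ∈ A) =>
      (shiftCoupling φ z p.1 : EReal) - p.2) (y, β) hmem
    rw [← hA z] at this
    exact this
  -- Finiteness of `f` rules out `β = ⊥`, which would force `f = ⊤`; `β = ⊤` contributes only `⊥`.
  induction β with
  | bot =>
    have := hle 0
    simp at this
  | top => simp at hlt'
  | coe c =>
    exact ⟨y, c, fun z => EReal.coe_le_coe_iff.1 (hle z), EReal.coe_lt_coe_iff.1 hlt'⟩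

/-! ### The `Φ`-conjugate -/

theorem coe_sub_le_phiConj (φ f : ℝ → ℝ) (x y : ℝ) :
    ((φ (x - y) - f x : ℝ) : EReal) ≤ phiConj (shiftCoupling φ) (toExt f) y :=
  le_iSup (fun x : ℝ => (shiftCoupling φ x y : EReal) - toExt f x) x

theorem phiConj_le_coe_iff {φ f : ℝ → ℝ} {y c : ℝ} :
    phiConj (shiftCoupling φ) (toExt f) y ≤ c ↔ ∀ x, φ (x - y) - f x ≤ c := by
  rw [phiConj, iSup_le_iff]
  exact forall_congr' fun x => EReal.coe_le_coe_iff (x := φ (x - y) - f x)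

theorem IsSupOfShifts.isGammaZero_phiConj {φ f : ℝ → ℝ} (hf : IsSupOfShifts φ f)
    (hφ : ConvexOn ℝ Set.univ φ) : IsGammaZero (phiConj (shiftCoupling φ) (toExt f)) where
  proper := ⟨fun y => (EReal.bot_lt_coe _).trans_le (coe_sub_le_phiConj φ f 0 y),
    hf.phiConj_lt_top⟩
  lsc := by
    have hφc : Continuous φ := continuousOn_univ.1 (hφ.continuousOn isOpen_univ)
    refine lowerSemicontinuous_iSup fun x => Continuous.lowerSemicontinuous ?_
    exact continuous_coe_real_ereal.comp
      (show Continuous fun y => φ (x - y) - f x by fun_prop)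
  convex := by
    rintro ⟨y, r⟩ hy ⟨z, t⟩ hz a b ha hb hab
    simp only [Set.mem_ofPred_eq, phiConj_le_coe_iff] at hy hz ⊢
    intro x
    have h1 := hφ.2 (Set.mem_univ (x - y)) (Set.mem_univ (x - z)) ha hb hab
    have h2 := mul_le_mul_of_nonneg_left (hy x) ha
    have h3 := mul_le_mul_of_nonneg_left (hz x) hb
    have hbe : b = 1 - a := by linarith
    subst hbe
    simp only [smul_eq_mul, Prod.smul_mk, Prod.mk_add_mk] at h1 ⊢
    rw [show a * (x - y) + (1 - a) * (x - z) = x - (a * y + (1 - a) * z) by ring] at h1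
    linarith

theorem IsSupOfShifts.toExt_eq_supConv {φ f : ℝ → ℝ} (hf : IsSupOfShifts φ f) :
    toExt f = supConv (fun y => -phiConj (shiftCoupling φ) (toExt f) y) φ := by
  funext x
  refine le_antisymm (EReal.ge_of_forall_gt_iff_ge.1 fun z hz => ?_) (iSup_le fun y => ?_)
  · have hz' : z < f x := EReal.coe_lt_coe_iff.1 hz
    obtain ⟨y, c, hle, hlt⟩ := hf x (f x - z) (by linarith)
    refine le_iSup_of_le y ?_
    have hc : phiConj (shiftCoupling φ) (toExt f) y ≤ c :=
      phiConj_le_coe_iff.2 fun x => by linarith [hle x]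
    calc (z : EReal) ≤ ((φ (x - y) - c : ℝ) : EReal) := EReal.coe_le_coe_iff.2 (by linarith)
      _ = (φ (x - y) : EReal) + -(c : EReal) := rfl
      _ ≤ _ := add_le_add_right (EReal.neg_le_neg_iff.2 hc) _
  · calc (φ (x - y) : EReal) + -phiConj (shiftCoupling φ) (toExt f) y
        ≤ (φ (x - y) : EReal) + -((φ (x - y) - f x : ℝ) : EReal) :=
          add_le_add_right (EReal.neg_le_neg_iff.2 (coe_sub_le_phiConj φ f x y)) _
      _ = ((φ (x - y) - (φ (x - y) - f x) : ℝ) : EReal) := rfl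
      _ = toExt f x := by rw [sub_sub_cancel]; rfl

theorem isPhiConvex_supConv_neg (φ : ℝ → ℝ) (g : ℝ → EReal) :
    IsPhiConvex (shiftCoupling φ) (supConv (fun y => -g y) φ) := by
  refine ⟨{p | p.2 = g p.1}, fun x => le_antisymm (iSup_le fun y => ?_) (iSup₂_le ?_)⟩
  · exact le_iSup₂ (f := fun (p : ℝ × EReal) (_ : p ∈ {p : ℝ × EReal | p.2 = g p.1}) =>
      (shiftCoupling φ x p.1 : EReal) - p.2) (y, g y) rfl
  · rintro ⟨y, β⟩ hβ
    obtain rfl : β = g y := hβ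
    exact le_iSup (fun y : ℝ => (φ (x - y) : EReal) + -g y) y

/-! ### Anisotropic strong convexity and the saddle-point property -/

theorem IsSupOfShifts.isAnisotropicallyStronglyConvex {φ f : ℝ → ℝ}
    (hφ : IsReferenceFunction φ) (hf : IsSupOfShifts φ f) :
    IsAnisotropicallyStronglyConvex φ (toExt f) where
  proper := ⟨fun x => EReal.bot_lt_coe _, 0, EReal.coe_lt_top _⟩
  lsc := (continuous_coe_real_ereal.comp (continuousOn_univ.1
    ((hf.convexOn hφ.convexOn).continuousOn isOpen_univ))).lowerSemicontinuous
  subgradient_ineq a v hv x := by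
    have hsub := (hf.convexOn hφ.convexOn).add_mul_le_of_mem_limitingSubdiff hv
    rw [hφ.erealDeriv_convexConj]
    rw [← hφ.deriv_derivIso_symm v] at hsub
    have h := hf.sub_le_sub hφ.convexOn hφ.differentiable hφ.strictMono_deriv hsub x
    exact EReal.coe_le_coe_iff.2 (show f a + φ (x - a + hφ.derivIso.symm v) -
      φ (hφ.derivIso.symm v) ≤ f x by linarith)

theorem IsSupOfShifts.saddlePointProperty {φ f : ℝ → ℝ} (hφ : IsReferenceFunction φ)
    (hf : IsSupOfShifts φ f) (v : ℝ) : SaddlePointProperty (shiftCoupling φ) (toExt f) v := by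
  refine le_antisymm (iSup_iInf_le_iInf_iSup _) (EReal.le_of_forall_lt_iff_le.1 fun c hc => ?_)
  -- Any real `c` above the sup-inf bounds `f*(v)`.
  have hconj : ∀ a, a * v - f a ≤ c := fun a => by
    refine EReal.coe_le_coe_iff.1 (le_trans ?_ hc.le)
    refine le_iSup_of_le a (le_iInf fun y => ?_)
    calc ((a * v - f a : ℝ) : EReal)
        = ((a * v - φ (a - y) : ℝ) : EReal) + ((φ (a - y) - f a : ℝ) : EReal) := by
          rw [← EReal.coe_add]; congr 1; ring
      _ ≤ _ := add_le_add_right (coe_sub_le_phiConj φ f a y) _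
  set s := hφ.derivIso.symm with hs
  -- `ψ w` is the Fenchel–Young gap of `φ` at `(s w, v)`: the excess incurred by using the slope `w`
  -- in place of `v`. It is continuous and vanishes at `v`.
  set ψ : ℝ → ℝ := fun w => (s v * v - φ (s v)) - (s w * v - φ (s w)) with hψ
  have hψc : Continuous ψ := by
    have h1 : Continuous s := s.continuous
    have h2 : Continuous φ := hφ.differentiable.continuous
    fun_prop
  refine EReal.le_of_forall_lt_iff_le.1 fun d hd => ?_
  have hd' : c < d := EReal.coe_lt_coe_iff.1 hd
  have hψ0 : ψ v = 0 := sub_self _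
  have hev : ∀ᶠ w in 𝓝 v, ψ w < d - c :=
    (hψc.tendsto v).eventually_lt_const (by rw [hψ0]; linarith)
  obtain ⟨ε, hε, hball⟩ := Metric.eventually_nhds_iff.1 hev
  obtain ⟨a, w, hw, hsub⟩ := (hf.convexOn hφ.convexOn).exists_subgradient_near hconj (half_pos hε)
  have hψw : ψ w < d - c := hball (by rw [Real.dist_eq]; linarith)
  rw [← hφ.deriv_derivIso_symm w] at hsub
  have hle := hf.sub_le_sub hφ.convexOn hφ.differentiable hφ.strictMono_deriv hsub
  have hg : phiConj (shiftCoupling φ) (toExt f) (a - s w) ≤ ((φ (s w) - f a : ℝ) : EReal) :=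
    phiConj_le_coe_iff.2 fun x => by
      have := hle x
      rw [← hs, show x - a + s w = x - (a - s w) by ring] at this
      linarith
  -- At this `y` the inner supremum is at most `(a * v - f a) + ψ w`, below `c + (d - c)`.
  refine iInf_le_of_le (a - s w) (iSup_le fun x => ?_)
  calc ((x * v - φ (x - (a - s w)) : ℝ) : EReal) + phiConj (shiftCoupling φ) (toExt f) (a - s w)
      ≤ ((x * v - φ (x - (a - s w)) : ℝ) : EReal) + ((φ (s w) - f a : ℝ) : EReal) :=
        add_le_add_right hg _
    _ = ((x * v - φ (x - (a - s w)) + (φ (s w) - f a) : ℝ) : EReal) := rfl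
    _ ≤ d := by
      refine EReal.coe_le_coe_iff.2 ?_
      have h1 := hφ.mul_sub_le (x - (a - s w)) v
      have h2 := hconj a
      simp only [hψ] at hψw
      rw [← hs] at h1
      linarith

theorem proposition5p4 (φ : ℝ → ℝ) (hφ : IsReferenceFunction φ) (f : ℝ → ℝ) :
    (IsPhiConvex (shiftCoupling φ) (toExt f) ↔
      ∃ g : ℝ → EReal, IsGammaZero g ∧ toExt f = supConv (fun y => -g y) φ) ∧
    (IsPhiConvex (shiftCoupling φ) (toExt f) →
      IsAnisotropicallyStronglyConvex φ (toExt f) ∧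
      ∀ v : ℝ, SaddlePointProperty (shiftCoupling φ) (toExt f) v) := by
  refine ⟨⟨fun h => ?_, ?_⟩, fun h => ?_⟩
  · exact ⟨_, h.isSupOfShifts.isGammaZero_phiConj hφ.convexOn, h.isSupOfShifts.toExt_eq_supConv⟩
  · rintro ⟨g, -, hg⟩
    rw [hg]
    exact isPhiConvex_supConv_neg φ g
  · exact ⟨h.isSupOfShifts.isAnisotropicallyStronglyConvex hφ,
      h.isSupOfShifts.saddlePointProperty hφ⟩
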